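/- Let $n\ge 1$ and $0\le m\le\lfloor n/2\rfloor$ be integers. For $b=(b_0,\dots,b_m)\in\mathbb C^{m+1}$ let $B_{(n-m,m)}=B_{(n-m,m)}(b)$ be the complex matrix whose rows and columns are indexed by the $m$-element subsets of $\{1,\dots,n\}$ and whose $(\sigma,\tau)$ entry is $b_p$ with $p=\#(\sigma\cap\tau)$. It acts on the space $M=\mathbb C^{\binom nm}$ whose standard basis is the set of $m$-element subsets. Then there are nonzero subspaces $V_0,\dots,V_m$ of $M$ with $M=V_0\oplus\cdots\oplus V_m$, and integers $a_{k,p}$ $(0\le k,p\le m)$, all depending only on $n$ and $m$, such that: 1. The eigenspaces do not depend on a generic choice of $b$: there is a nonzero polynomial $P\in\mathbb C[x_0,\dots,x_m]$ such that for every $b$ with $P(b)\ne 0$ the set of (nonzero) eigenspaces of $B_{(n-m,m)}(b)$ is $\{V_0,\dots,V_m\}$. 2. The eigenvalues are $\mathbb Z$-linear combinations of $b_0,\dots,b_m$: for every $b\in\mathbb C^{m+1}$ and every $k$, $B_{(n-m,m)}(b)$ acts on $V_k$ as multiplication by $\lambda_k(b)=\sum_{p=0}^m a_{k,p}b_p$,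 and the eigenvalues of $B_{(n-m,m)}(b)$ are exactly the numbers $\lambda_0(b),\dots,\lambda_m(b)$. -/

import Mathlib

/-- The set of `m`-element subsets of an `n`-element set. -/
abbrev Combinations (n m : ℕ) : Type := {s : Finset (Fin n) // s.card = m}

/-- The matrix `B_{(n-m,m)}`, with rows and columns indexed by the `m`-element subsets of an
`n`-element set; the entry at `(σ, τ)` is `b_p`, where `p` is the number of elements of `σ ∩ τ`. -/
def intertwiningMatrix (n m : ℕ) (b : Fin (m + 1) → ℂ) :
    Matrix (Combinations n m) (Combinations n m) ℂ :=
  Matrix.of fun σ τ =>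
    b ⟨(σ.1 ∩ τ.1).card,
      Nat.lt_succ_of_le ((Finset.card_le_card Finset.inter_subset_left).trans_eq σ.2)⟩

/-- `B_{(n-m,m)}` as an endomorphism of the space with standard basis the `m`-element subsets. -/
noncomputable def intertwiningEnd (n m : ℕ) (b : Fin (m + 1) → ℂ) :
    Module.End ℂ (Combinations n m → ℂ) :=
  Matrix.toLin' (intertwiningMatrix n m b)

/-- The set of all (nonzero) eigenspaces of an endomorphism. -/
def eigenspaceSet {E : Type*} [AddCommGroup E] [Module ℂ E] (f : Module.End ℂ E) :
    Set (Submodule ℂ E) :=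
  {W | ∃ μ : ℂ, f.HasEigenvalue μ ∧ W = f.eigenspace μ}

/-! Filter the space by `containSpan n m j` and let V_k be the orthogonal difference of consecutive
steps. The entry of B applied to the indicator of J at σ is a combination of the b_p with
coefficients `meetCount`. By symmetry these depend only on |J| and |J ∩ σ|. Expanded in binomials of
|J ∩ σ|, they become sums of indicators of subsets of J, and the integer coefficient at J itself is
a_{k,p} for k = |J|. So B is triangular on the filtration with scalar diagonal; being symmetric, it
acts on V_k as that scalar. V_k is nonzero because an alternating sum over switched sets kills one
filtration step but not the next. The choice b_p = C(p, j) separates λ_j from every later λ_k, so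
the λ_k are distinct linear forms, and the product of their differences is the required P. -/

section

open Matrix

/-- The indicator function, on the `m`-element subsets, of those containing `J`. -/
noncomputable def containIndicator (n m : ℕ) (J : Finset (Fin n)) : Combinations n m → ℂ :=
  fun σ => if J ⊆ σ.1 then 1 else 0

/-- The span of the indicators of containment of a set with fewer than `j` elements. -/
noncomputable def containSpan (n m j : ℕ) : Submodule ℂ (Combinations n m → ℂ) :=
  Submodule.span ℂ (containIndicator n m '' {J | J.card < j})

/-- The annihilator of a space of functions for the standard bilinear form. -/
def dotOrthogonal {ι : Type*} [Fintype ι] (U : Submodule ℂ (ι → ℂ)) : Submodule ℂ (ι → ℂ) where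
  carrier := {v | ∀ u ∈ U, u ⬝ᵥ v = 0}
  add_mem' {v w} hv hw u hu := by rw [dotProduct_add, hv u hu, hw u hu, add_zero]
  zero_mem' u _ := dotProduct_zero u
  smul_mem' c v hv u hu := by rw [dotProduct_smul, hv u hu, smul_zero]

/-- The `j`-th common eigenspace of the matrices `B_{(n-m,m)}`. -/
noncomputable def johnsonSpace (n m j : ℕ) : Submodule ℂ (Combinations n m → ℂ) :=
  containSpan n m (j + 1) ⊓ dotOrthogonal (containSpan n m j)

/-! ### Orthogonality and the containment filtration -/

/-- Stability under conjugation turns the bilinear annihilator into the Hermitian complement;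
without it, isotropic vectors would spoil the splitting. -/
theorem exists_add_dotOrthogonal {ι : Type*} [Fintype ι] (U : Submodule ℂ (ι → ℂ))
    (hU : ∀ u ∈ U, star u ∈ U) (v : ι → ℂ) : ∃ u ∈ U, ∃ w ∈ dotOrthogonal U, v = u + w := by
  let e := WithLp.linearEquiv 2 ℂ (ι → ℂ)
  let K : Submodule ℂ (EuclideanSpace ℂ ι) := U.comap e.toLinearMap
  obtain ⟨y, hy, z, hz, h⟩ := K.exists_add_mem_mem_orthogonal (WithLp.toLp 2 v)
  refine ⟨e y, hy, e z, fun u hu => ?_, ?_⟩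
  · have h1 := (Submodule.mem_orthogonal K z).1 hz (WithLp.toLp 2 (star u)) (hU u hu)
    rw [EuclideanSpace.inner_eq_star_dotProduct] at h1
    rw [star_star, dotProduct_comm] at h1
    exact h1
  · exact congrArg e h

theorem disjoint_dotOrthogonal {ι : Type*} [Fintype ι] (U : Submodule ℂ (ι → ℂ))
    (hU : ∀ u ∈ U, star u ∈ U) {v : ι → ℂ} (hv : v ∈ U) (hv' : v ∈ dotOrthogonal U) : v = 0 := by
  have h : ∑ i, ((Complex.normSq (v i) : ℝ) : ℂ) = 0 := by
    rw [← hv' _ (hU v hv)]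
    exact Finset.sum_congr rfl fun i _ => Complex.normSq_eq_conj_mul_self
  rw [← Complex.ofReal_sum, Complex.ofReal_eq_zero,
    Finset.sum_eq_zero_iff_of_nonneg fun _ _ => Complex.normSq_nonneg _] at h
  exact funext fun i => Complex.normSq_eq_zero.1 (h i (Finset.mem_univ i))

theorem star_containIndicator (n m : ℕ) (J : Finset (Fin n)) :
    star (containIndicator n m J) = containIndicator n m J := by
  ext σ
  simp only [containIndicator, Pi.star_apply]
  split_ifs <;> simp

theorem containIndicator_mem {n m j : ℕ} {J : Finset (Fin n)} (h : J.card < j) :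
    containIndicator n m J ∈ containSpan n m j :=
  Submodule.subset_span ⟨J, h, rfl⟩

theorem star_mem_containSpan (n m j : ℕ) (u : Combinations n m → ℂ)
    (hu : u ∈ containSpan n m j) : star u ∈ containSpan n m j := by
  induction hu using Submodule.span_induction with
  | mem x hx =>
    obtain ⟨J, hJ, rfl⟩ := hx
    rw [star_containIndicator]
    exact containIndicator_mem hJ
  | zero => rw [star_zero]; exact zero_mem _
  | add x y _ _ hx hy => rw [star_add]; exact add_mem hx hy
  | smul c x _ hx => rw [star_smul]; exact Submodule.smul_mem _ _ hx

theorem containSpan_mono {n m i j : ℕ} (h : i ≤ j) : containSpan n m i ≤ containSpan n m j :=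
  Submodule.span_mono (Set.image_mono fun _ hJ => lt_of_lt_of_le hJ h)

theorem containSpan_succ_self (n m : ℕ) : containSpan n m (m + 1) = ⊤ := by
  refine eq_top_iff.2 fun v _ => ?_
  have h : v = ∑ σ : Combinations n m, v σ • containIndicator n m σ.1 := by
    ext τ
    rw [Finset.sum_apply, Finset.sum_eq_single τ]
    · simp [containIndicator]
    · intro σ _ hσ
      have : ¬ σ.1 ⊆ τ.1 := fun h =>
        hσ (Subtype.ext (Finset.eq_of_subset_of_card_le h (by rw [σ.2, τ.2])))
      simp [containIndicator, this]
    · simp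
  rw [h]
  exact Submodule.sum_mem _ fun σ _ =>
    Submodule.smul_mem _ _ (containIndicator_mem (by rw [σ.2]; exact Nat.lt_succ_self m))

/-! ### Counting sets that contain J and meet σ in p points -/

/-- Pairs of subsets of a finite type are conjugate under permutations as soon as their
cardinalities and that of their intersection agree. -/
theorem exists_perm_map_eq {α : Type*} [Fintype α] [DecidableEq α] {s t s' t' : Finset α}
    (hs : s.card = s'.card) (ht : t.card = t'.card) (hst : (s ∩ t).card = (s' ∩ t').card) :
    ∃ π : Equiv.Perm α, (∀ x, π x ∈ s' ↔ x ∈ s) ∧ ∀ x, π x ∈ t' ↔ x ∈ t := by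
  -- The three cardinalities determine the sizes of all four Venn regions, which are then matched
  -- one by one.
  have key : ∀ c : Bool × Bool,
      Fintype.card {a : α // (decide (a ∈ s), decide (a ∈ t)) = c} =
        Fintype.card {a : α // (decide (a ∈ s'), decide (a ∈ t')) = c} := by
    have h1 := Finset.card_sdiff_add_card_inter s t
    have h2 := Finset.card_sdiff_add_card_inter s' t'
    have h3 := Finset.card_sdiff_add_card_inter t s
    have h4 := Finset.card_sdiff_add_card_inter t' s'
    have h5 := Finset.card_compl_add_card (s ∪ t)
    have h6 := Finset.card_compl_add_card (s' ∪ t')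
    have h7 := Finset.card_union_add_card_inter s t
    have h8 := Finset.card_union_add_card_inter s' t'
    rw [Finset.inter_comm] at h3 h4
    rintro ⟨x, y⟩
    rw [Fintype.card_subtype, Fintype.card_subtype]
    have e : ∀ u v : Finset α,
        Finset.univ.filter (fun a => (decide (a ∈ u), decide (a ∈ v)) = (x, y)) =
          match x, y with
          | true, true => u ∩ v
          | true, false => u \ v
          | false, true => v \ u
          | false, false => (u ∪ v)ᶜ := by
      intro u v
      ext a
      cases x <;> cases y <;> simp [and_comm]
    rw [e, e]
    cases x <;> cases y <;> simp only <;> omega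
  let π : Equiv.Perm α := Equiv.ofFiberEquiv fun c => Fintype.equivOfCardEq (key c)
  have hπ : ∀ x, (decide (π x ∈ s'), decide (π x ∈ t')) = (decide (x ∈ s), decide (x ∈ t)) :=
    Equiv.ofFiberEquiv_map (f := fun a => (decide (a ∈ s), decide (a ∈ t)))
      (g := fun a => (decide (a ∈ s'), decide (a ∈ t'))) fun c => Fintype.equivOfCardEq (key c)
  exact ⟨π, fun x => by simpa using (Prod.ext_iff.1 (hπ x)).1,
    fun x => by simpa using (Prod.ext_iff.1 (hπ x)).2⟩

/-- The number of `m`-element sets containing `J` and meeting `σ` in `p` elements. -/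
def meetCount {n : ℕ} (m p : ℕ) (J σ : Finset (Fin n)) : ℕ :=
  (Finset.univ.filter fun τ : Combinations n m => J ⊆ τ.1 ∧ (σ ∩ τ.1).card = p).card

theorem meetCount_congr {n : ℕ} (m p : ℕ) {J J' σ σ' : Finset (Fin n)} (hJ : J.card = J'.card)
    (hσ : σ.card = σ'.card) (h : (J ∩ σ).card = (J' ∩ σ').card) :
    meetCount m p J σ = meetCount m p J' σ' := by
  obtain ⟨π, h1, h2⟩ := exists_perm_map_eq hJ hσ h
  have hJ' : J' = J.map π.toEmbedding := by
    ext x; rw [← π.apply_symm_apply x, h1]; simp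
  have hσ' : σ' = σ.map π.toEmbedding := by
    ext x; rw [← π.apply_symm_apply x, h2]; simp
  subst hJ' hσ'
  refine Finset.card_bij (fun τ _ => ⟨τ.1.map π.toEmbedding, by rw [Finset.card_map, τ.2]⟩) ?_ ?_ ?_
  · intro τ hτ
    simpa [← Finset.map_inter] using hτ
  · intro τ _ τ' _ h
    exact Subtype.ext (Finset.map_injective _ (Subtype.ext_iff.1 h))
  · intro τ hτ
    have e : (τ.1.map π.symm.toEmbedding).map π.toEmbedding = τ.1 := by
      ext x; simp
    refine ⟨⟨τ.1.map π.symm.toEmbedding, by rw [Finset.card_map, τ.2]⟩, ?_, Subtype.ext e⟩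
    rw [Finset.mem_filter, ← e] at hτ
    simpa [← Finset.map_inter] using hτ

theorem exists_meetCount_eq (n m p : ℕ) : ∃ F : ℕ → ℕ → ℤ,
    ∀ (J : Finset (Fin n)) (σ : Combinations n m),
      (meetCount m p J σ.1 : ℤ) = F J.card (J ∩ σ.1).card := by
  let g : Finset (Fin n) × Combinations n m → ℕ × ℕ := fun x => (x.1.card, (x.1 ∩ x.2.1).card)
  let f : Finset (Fin n) × Combinations n m → ℤ := fun x => meetCount m p x.1 x.2.1
  have hf : f.FactorsThrough g := fun x y hxy => by
    have := Prod.ext_iff.1 hxy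
    exact congrArg Nat.cast (meetCount_congr m p this.1 (x.2.2.trans y.2.2.symm) this.2)
  -- Pairs realised by no J and σ get the value 0; the Newton expansion holds whatever these values
  -- are.
  exact ⟨fun j i => Function.extend g f 0 (j, i), fun J σ => (hf.extend_apply 0 (J, σ)).symm⟩

theorem exists_newton_expansion (F : ℕ → ℤ) :
    ∃ c : ℕ → ℤ, ∀ i j, i ≤ j → F i = ∑ l ∈ Finset.range (j + 1), c l * (i.choose l : ℤ) := by
  refine ⟨fun l => (fwdDiff 1)^[l] F 0, fun i j hij => ?_⟩
  have h := shift_eq_sum_fwdDiff_iter 1 F i 0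
  simp only [smul_eq_mul, mul_one, zero_add, nsmul_eq_mul] at h
  -- Terms with i < l vanish, so the range of summation can be made independent of i.
  rw [h, Finset.sum_subset (Finset.range_mono (Nat.succ_le_succ hij))]
  · exact Finset.sum_congr rfl fun l _ => mul_comm _ _
  · intro l _ hl
    rw [Nat.choose_eq_zero_of_lt (by simpa using hl)]
    simp

theorem choose_card_inter_eq_sum {n m : ℕ} (l : ℕ) (J : Finset (Fin n)) (σ : Combinations n m) :
    (((J ∩ σ.1).card.choose l : ℕ) : ℂ) =
      ∑ L ∈ J.powersetCard l, containIndicator n m L σ := by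
  rw [← Finset.card_powersetCard]
  simp only [containIndicator, Finset.sum_boole]
  congr 2
  ext L
  simp only [Finset.mem_powersetCard, Finset.mem_filter, Finset.subset_inter_iff]
  tauto

theorem exists_meetCount_expansion (n m : ℕ) : ∃ a : ℕ → ℕ → ℤ,
    ∀ (p : ℕ) (J : Finset (Fin n)),
      (fun σ : Combinations n m => (meetCount m p J σ.1 : ℂ)) -
        (a J.card p : ℂ) • containIndicator n m J ∈ containSpan n m J.card := by
  choose F hF using exists_meetCount_eq n m
  choose c hc using fun p j => exists_newton_expansion (F p j)
  -- For l = |J| the only l-subset of J is J itself; smaller l contributes to the lower filtration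
  -- step.
  refine ⟨fun j p => c p j j, fun p J => ?_⟩
  have h : (fun σ : Combinations n m => (meetCount m p J σ.1 : ℂ)) -
        (c p J.card J.card : ℂ) • containIndicator n m J =
      ∑ l ∈ Finset.range J.card, (c p J.card l : ℂ) •
        ∑ L ∈ J.powersetCard l, containIndicator n m L := by
    ext σ
    have h1 : (meetCount m p J σ.1 : ℂ) = ((meetCount m p J σ.1 : ℤ) : ℂ) := by push_cast; rfl
    have h2 : (J ∩ σ.1).card ≤ J.card := Finset.card_le_card Finset.inter_subset_left
    simp only [Pi.sub_apply, Pi.smul_apply, Finset.sum_apply, smul_eq_mul]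
    rw [h1, hF, hc p J.card _ _ h2, Finset.sum_range_succ]
    push_cast
    simp only [choose_card_inter_eq_sum]
    simp
  rw [h]
  exact Submodule.sum_mem _ fun l hl => Submodule.smul_mem _ _ <| Submodule.sum_mem _ fun L hL =>
    containIndicator_mem (by rw [(Finset.mem_powersetCard.1 hL).2]; exact Finset.mem_range.1 hl)

/-! ### Triangular action on the filtration -/

theorem intertwiningEnd_containIndicator {n m : ℕ} (b : Fin (m + 1) → ℂ) (J : Finset (Fin n)) :
    intertwiningEnd n m b (containIndicator n m J) =
      ∑ p, b p • fun σ : Combinations n m => (meetCount m p J σ.1 : ℂ) := by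
  ext σ
  simp only [intertwiningEnd, toLin'_apply, mulVec, dotProduct, intertwiningMatrix, of_apply,
    containIndicator, Finset.sum_apply, Pi.smul_apply, smul_eq_mul, meetCount, mul_boole]
  simp only [Finset.card_filter, Nat.cast_sum, Finset.mul_sum]
  rw [Finset.sum_comm]
  refine Finset.sum_congr rfl fun τ _ => ?_
  rw [Finset.sum_eq_single_of_mem
    ⟨(σ.1 ∩ τ.1).card,
      Nat.lt_succ_of_le ((Finset.card_le_card Finset.inter_subset_left).trans_eq σ.2)⟩
    (Finset.mem_univ _)]
  · simp
  · intro p _ hp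
    have : (σ.1 ∩ τ.1).card ≠ p := fun h => hp (Fin.ext h.symm)
    simp [this]

theorem dotProduct_intertwiningEnd {n m : ℕ} (b : Fin (m + 1) → ℂ) (u v : Combinations n m → ℂ) :
    u ⬝ᵥ intertwiningEnd n m b v = intertwiningEnd n m b u ⬝ᵥ v := by
  have h : (intertwiningMatrix n m b)ᵀ = intertwiningMatrix n m b := by
    ext σ τ
    simp only [intertwiningMatrix, transpose_apply, of_apply, Finset.inter_comm]
  simp only [intertwiningEnd, toLin'_apply]
  rw [dotProduct_mulVec, ← mulVec_transpose, h]

theorem exists_johnsonSpace_le_eigenspace (n m : ℕ) : ∃ a : ℕ → ℕ → ℤ,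
    ∀ (b : Fin (m + 1) → ℂ) (k : ℕ),
      johnsonSpace n m k ≤
        (intertwiningEnd n m b).eigenspace (∑ p : Fin (m + 1), (a k p : ℂ) * b p) := by
  obtain ⟨a, ha⟩ := exists_meetCount_expansion n m
  refine ⟨a, fun b => ?_⟩
  have key : ∀ J : Finset (Fin n), intertwiningEnd n m b (containIndicator n m J) -
      (∑ p : Fin (m + 1), (a J.card p : ℂ) * b p) • containIndicator n m J ∈
        containSpan n m J.card := by
    intro J
    rw [intertwiningEnd_containIndicator, Finset.sum_smul, ← Finset.sum_sub_distrib]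
    refine Submodule.sum_mem _ fun p _ => ?_
    rw [mul_comm, mul_smul, ← smul_sub]
    exact Submodule.smul_mem _ _ (ha p J)
  have inv : ∀ j, ∀ u ∈ containSpan n m j, intertwiningEnd n m b u ∈ containSpan n m j := by
    intro j
    refine fun u hu => (Submodule.span_le.2 ?_ : containSpan n m j ≤
      (containSpan n m j).comap (intertwiningEnd n m b)) hu
    rintro _ ⟨J, hJ, rfl⟩
    have := add_mem (containSpan_mono (le_of_lt hJ) (key J))
      (Submodule.smul_mem _ (∑ p : Fin (m + 1), (a J.card p : ℂ) * b p) (containIndicator_mem hJ))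
    rwa [sub_add_cancel] at this
  intro k v hv
  rw [Module.End.mem_eigenspace_iff, ← sub_eq_zero]
  set μ := ∑ p : Fin (m + 1), (a k p : ℂ) * b p with hμ
  -- Bv - μv lies in `containSpan n m k` by triangularity and in its annihilator by symmetry of B.
  refine disjoint_dotOrthogonal (containSpan n m k) (star_mem_containSpan n m k) ?_ ?_
  · refine (Submodule.span_le.2 ?_ : containSpan n m (k + 1) ≤
      (containSpan n m k).comap (intertwiningEnd n m b - μ • LinearMap.id)) hv.1
    rintro _ ⟨J, hJ, rfl⟩
    change intertwiningEnd n m b _ - μ • _ ∈ containSpan n m k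
    rcases Nat.lt_succ_iff_lt_or_eq.1 hJ with h | h
    · exact sub_mem (inv k _ (containIndicator_mem h))
        (Submodule.smul_mem _ _ (containIndicator_mem h))
    · have := key J
      rwa [h] at this
  · refine sub_mem (fun u hu => ?_) (Submodule.smul_mem _ _ hv.2)
    rw [dotProduct_intertwiningEnd]
    exact hv.2 _ (inv k u hu)

theorem containSpan_le_iSup_johnsonSpace (n m j : ℕ) :
    containSpan n m j ≤ ⨆ k : Fin j, johnsonSpace n m k := by
  induction j with
  | zero => exact Submodule.span_le.2 (by rintro _ ⟨J, hJ, rfl⟩; exact absurd hJ (Nat.not_lt_zero _))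
  | succ j ih =>
    intro v hv
    obtain ⟨u, hu, w, hw, rfl⟩ :=
      exists_add_dotOrthogonal _ (star_mem_containSpan n m j) v
    have hu' := containSpan_mono (Nat.le_succ j) hu
    refine add_mem ?_ ?_
    · exact (iSup_le fun k : Fin j => le_iSup (fun k : Fin (j + 1) => johnsonSpace n m k)
        k.castSucc) (ih hu)
    · exact le_iSup (fun k : Fin (j + 1) => johnsonSpace n m k) (Fin.last j)
        ⟨by simpa using sub_mem hv hu', hw⟩

theorem iSup_johnsonSpace (n m : ℕ) : ⨆ k : Fin (m + 1), johnsonSpace n m k = ⊤ :=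
  top_le_iff.1 ((containSpan_succ_self n m).symm.le.trans (containSpan_le_iSup_johnsonSpace n m _))

/-! ### Nonvanishing of the eigenspaces -/

/-- The set obtained from `{0, …, m - 1}` by replacing each `i ∈ S` by `m + i`. -/
def switchSet {n m : ℕ} (h : 2 * m ≤ n) (S : Finset ℕ) : Combinations n m :=
  ⟨Finset.univ.image fun i : Fin m =>
      (⟨if i.1 ∈ S then m + i else i, by split_ifs <;> omega⟩ : Fin n), by
    rw [Finset.card_image_of_injective, Finset.card_univ, Fintype.card_fin]
    intro i i' hi
    have := Fin.ext_iff.1 hi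
    simp only at this
    ext
    split_ifs at this <;> omega⟩

theorem mem_switchSet {n m : ℕ} (h : 2 * m ≤ n) (S : Finset ℕ) (x : Fin n) :
    x ∈ (switchSet h S).1 ↔ ∃ i < m, (if i ∈ S then m + i else i) = x.1 := by
  simp only [switchSet, Finset.mem_image, Finset.mem_univ, true_and, Fin.ext_iff]
  exact ⟨fun ⟨i, hi⟩ => ⟨i, i.2, hi⟩, fun ⟨i, hm, hi⟩ => ⟨⟨i, hm⟩, hi⟩⟩

theorem sum_switchSet_containIndicator {n m j : ℕ} (h : 2 * m ≤ n) (hj : j ≤ m)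
    {L : Finset (Fin n)} (hL : L.card < j) :
    ∑ S ∈ (Finset.range j).powerset, (-1 : ℂ) ^ S.card * containIndicator n m L (switchSet h S)
      = 0 := by
  -- L has too few elements to meet every pair {i, m + i} with i < j; toggling a missed i reverses
  -- the sign and preserves the containment.
  obtain ⟨i, hi, hiL⟩ : ∃ i ∈ Finset.range j, i ∉ L.image fun x => x.1 % m :=
    Finset.exists_mem_notMem_of_card_lt_card
      (Finset.card_image_le.trans_lt (by rwa [Finset.card_range]))
  have hij := Finset.mem_range.1 hi
  obtain ⟨t, ht, htj⟩ : ∃ t, i ∉ t ∧ Finset.range j = insert i t :=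
    ⟨(Finset.range j).erase i, Finset.notMem_erase _ _, (Finset.insert_erase hi).symm⟩
  rw [htj, Finset.sum_powerset_insert ht, ← Finset.sum_add_distrib]
  refine Finset.sum_eq_zero fun S hS => ?_
  have hiS : i ∉ S := fun h => ht (Finset.mem_powerset.1 hS h)
  have e : L ⊆ (switchSet h (insert i S)).1 ↔ L ⊆ (switchSet h S).1 := by
    refine forall₂_congr fun x hx => ?_
    rw [mem_switchSet, mem_switchSet]
    have hx' : x.1 % m ≠ i := fun h => hiL (Finset.mem_image.2 ⟨x, hx, h⟩)
    have him : i % m = i := Nat.mod_eq_of_lt (by omega)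
    refine exists_congr fun i' => and_congr_right fun _ => ?_
    by_cases hii : i' = i
    · subst hii
      have h1 : x.1 ≠ i' := fun h => hx' (by rw [h, him])
      have h2 : x.1 ≠ m + i' := fun h => hx' (by rw [h, Nat.add_mod_left, him])
      simp [hiS, h1.symm, h2.symm]
    · simp [hii]
  rw [Finset.card_insert_of_notMem hiS]
  simp only [containIndicator, e]
  ring

theorem johnsonSpace_ne_bot {n m j : ℕ} (h : 2 * m ≤ n) (hj : j ≤ m) :
    johnsonSpace n m j ≠ ⊥ := by
  intro hbot
  have hle : containSpan n m (j + 1) ≤ containSpan n m j := by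
    intro v hv
    obtain ⟨u, hu, w, hw, rfl⟩ := exists_add_dotOrthogonal _ (star_mem_containSpan n m j) v
    have hw' : w ∈ johnsonSpace n m j :=
      ⟨by simpa using sub_mem hv (containSpan_mono (Nat.le_succ j) hu), hw⟩
    rw [hbot, Submodule.mem_bot] at hw'
    rwa [hw', add_zero]
  -- φ vanishes on the lower step, but on the indicator of {0, …, j - 1} only S = ∅ contributes.
  let φ : (Combinations n m → ℂ) →ₗ[ℂ] ℂ :=
    ∑ S ∈ (Finset.range j).powerset, (-1 : ℂ) ^ S.card • LinearMap.proj (switchSet h S)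
  have hφ : ∀ u, φ u = ∑ S ∈ (Finset.range j).powerset, (-1 : ℂ) ^ S.card * u (switchSet h S) := by
    intro u
    simp [φ, LinearMap.sum_apply]
  have hker : containSpan n m j ≤ LinearMap.ker φ := by
    refine Submodule.span_le.2 ?_
    rintro _ ⟨L, hL, rfl⟩
    show φ _ = 0
    rw [hφ]
    exact sum_switchSet_containIndicator h hj hL
  let J : Finset (Fin n) := (Finset.range j).attachFin fun i hi => by
    have := Finset.mem_range.1 hi
    omega
  have hJ : φ (containIndicator n m J) = 0 :=
    hker (hle (containIndicator_mem (by simp [J])))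
  rw [hφ, Finset.sum_eq_single ∅] at hJ
  · have : J ⊆ (switchSet h ∅).1 := fun x hx => (mem_switchSet _ _ _).2
      ⟨x, by have : x.1 < j := by simpa [J] using hx
             omega, by simp⟩
    simp [containIndicator, this] at hJ
  · intro S hS hS0
    obtain ⟨i, hi⟩ := Finset.nonempty_iff_ne_empty.2 hS0
    have hij : i < j := Finset.mem_range.1 (Finset.mem_powerset.1 hS hi)
    have : ¬ J ⊆ (switchSet h S).1 := by
      intro hsub
      obtain ⟨i', _, hi'⟩ := (mem_switchSet _ _ _).1
        (hsub (show (⟨i, by omega⟩ : Fin n) ∈ J by simpa [J] using hij))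
      split_ifs at hi' with h1
      · simp only at hi'
        omega
      · exact h1 (by simpa [hi'] using hi)
    simp [containIndicator, this]
  · simp

/-! ### Separating the eigenvalues -/

/-- C(|σ ∩ τ|, j) counts the common j-subsets of σ and τ, so the matrix is a sum of rank-one
projections up to scale. -/
theorem intertwiningEnd_choose_apply {n m : ℕ} (j : ℕ) (v : Combinations n m → ℂ) :
    intertwiningEnd n m (fun p => ((p.1.choose j : ℕ) : ℂ)) v =
      ∑ L ∈ (Finset.univ : Finset (Fin n)).powersetCard j,
        (containIndicator n m L ⬝ᵥ v) • containIndicator n m L := by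
  ext σ
  simp only [intertwiningEnd, toLin'_apply, mulVec, intertwiningMatrix, of_apply,
    Finset.sum_apply, Pi.smul_apply, smul_eq_mul, dotProduct, Finset.sum_mul]
  rw [Finset.sum_comm]
  refine Finset.sum_congr rfl fun τ _ => ?_
  rw [choose_card_inter_eq_sum, Finset.sum_mul]
  have : σ.1.powersetCard j ⊆ (Finset.univ : Finset (Fin n)).powersetCard j :=
    Finset.powersetCard_mono (Finset.subset_univ _)
  rw [← Finset.sum_subset this]
  · refine Finset.sum_congr rfl fun L hL => ?_
    have : containIndicator n m L σ = 1 := if_pos (Finset.mem_powersetCard.1 hL).1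
    rw [this, mul_one]
  · intro L hL hL'
    have : containIndicator n m L σ = 0 := if_neg fun h =>
      hL' (Finset.mem_powersetCard.2 ⟨h, (Finset.mem_powersetCard.1 hL).2⟩)
    rw [this, mul_zero]

theorem exists_eigenvalue_ne {n m : ℕ} (h : 2 * m ≤ n) (c : ℕ → (Fin (m + 1) → ℂ) → ℂ)
    (hc : ∀ b k, johnsonSpace n m k ≤ (intertwiningEnd n m b).eigenspace (c k b))
    {j k : ℕ} (hjk : j < k) (hk : k ≤ m) : ∃ b, c j b ≠ c k b := by
  refine ⟨fun p => ((p.1.choose j : ℕ) : ℂ), ?_⟩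
  set b : Fin (m + 1) → ℂ := fun p => ((p.1.choose j : ℕ) : ℂ)
  have hk0 : c k b = 0 := by
    obtain ⟨v, hv, hv0⟩ := Submodule.exists_mem_ne_zero_of_ne_bot (johnsonSpace_ne_bot h hk)
    have h1 := Module.End.mem_eigenspace_iff.1 (hc b k hv)
    rw [intertwiningEnd_choose_apply, Finset.sum_eq_zero] at h1
    · exact (smul_eq_zero.1 h1.symm).resolve_right hv0
    · intro L hL
      rw [hv.2 _ (containIndicator_mem (by rwa [(Finset.mem_powersetCard.1 hL).2])), zero_smul]
  rw [hk0]
  intro hj0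
  obtain ⟨v, hv, hv0⟩ :=
    Submodule.exists_mem_ne_zero_of_ne_bot (johnsonSpace_ne_bot h (hjk.le.trans hk))
  have h1 := Module.End.mem_eigenspace_iff.1 (hc b j hv)
  rw [intertwiningEnd_choose_apply, hj0, zero_smul] at h1
  -- Pairing with the conjugate of v gives a sum of squared moduli; its vanishing makes v orthogonal
  -- to the step containing it.
  have h2 := congrArg (fun w => star v ⬝ᵥ w) h1
  simp only [dotProduct_sum, dotProduct_smul, dotProduct_zero] at h2
  have h3 : ∀ L : Finset (Fin n), (containIndicator n m L ⬝ᵥ v) •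
      (star v ⬝ᵥ containIndicator n m L) =
        ((Complex.normSq (containIndicator n m L ⬝ᵥ v) : ℝ) : ℂ) := by
    intro L
    have : star v ⬝ᵥ containIndicator n m L = star (containIndicator n m L ⬝ᵥ v) := by
      rw [star_dotProduct, star_containIndicator]
    rw [this, smul_eq_mul, Complex.normSq_eq_conj_mul_self, mul_comm]
    rfl
  simp only [h3] at h2
  rw [← Complex.ofReal_sum, Complex.ofReal_eq_zero,
    Finset.sum_eq_zero_iff_of_nonneg fun _ _ => Complex.normSq_nonneg _] at h2
  refine hv0 (disjoint_dotOrthogonal _ (star_mem_containSpan n m (j + 1)) hv.1 fun u hu => ?_)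
  induction hu using Submodule.span_induction with
  | mem x hx =>
    obtain ⟨J, hJ, rfl⟩ := hx
    rcases Nat.lt_succ_iff_lt_or_eq.1 hJ with h' | h'
    · exact hv.2 _ (containIndicator_mem h')
    · exact Complex.normSq_eq_zero.1
        (h2 J (Finset.mem_powersetCard.2 ⟨Finset.subset_univ _, h'⟩))
  | zero => exact zero_dotProduct v
  | add x y _ _ hx hy => rw [add_dotProduct, hx, hy, add_zero]
  | smul c x _ hx => rw [smul_dotProduct, hx, smul_zero]

/-! ### Spectral generalities and conclusion -/

/-- Eigenspaces for distinct eigenvalues are independent, so spanning pieces leave no room for a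
larger eigenspace. -/
theorem eigenspace_eq_of_iSup_eq_top {ι K E : Type*} [Field K] [AddCommGroup E] [Module K E]
    {f : Module.End K E} {V : ι → Submodule K E} {μ : ι → K} (hμ : Function.Injective μ)
    (hV : ∀ i, V i ≤ f.eigenspace (μ i)) (htop : ⨆ i, V i = ⊤) (i : ι) :
    f.eigenspace (μ i) = V i := by
  refine le_antisymm ?_ (hV i)
  have hd := f.eigenspaces_iSupIndep (μ i)
  have hX : ⨆ (k) (_ : k ≠ i), V k ≤ ⨆ (ν) (_ : ν ≠ μ i), f.eigenspace ν :=
    iSup₂_le fun k hk => (hV k).trans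
      (le_iSup₂_of_le (f := fun ν (_ : ν ≠ μ i) => f.eigenspace ν) (μ k) (hμ.ne hk) le_rfl)
  have hsup : V i ⊔ ⨆ (k) (_ : k ≠ i), V k = ⊤ := by
    refine top_le_iff.1 (htop.symm.le.trans (iSup_le fun k => ?_))
    by_cases hk : k = i
    · subst hk; exact le_sup_left
    · exact le_sup_of_le_right (le_iSup₂_of_le (f := fun k (_ : k ≠ i) => V k) k hk le_rfl)
  intro v hv
  obtain ⟨x, hx, y, hy, rfl⟩ := Submodule.mem_sup.1 (hsup.symm.le (Submodule.mem_top (x := v)))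
  have hy' : y ∈ f.eigenspace (μ i) := by simpa using sub_mem hv (hV i hx)
  have : y = 0 := Submodule.disjoint_def.1 hd y hy' (hX hy)
  rwa [this, add_zero]

theorem exists_eq_of_hasEigenvalue {ι K E : Type*} [Field K] [AddCommGroup E] [Module K E]
    {f : Module.End K E} {V : ι → Submodule K E} {μ : ι → K}
    (hV : ∀ i, V i ≤ f.eigenspace (μ i)) (htop : ⨆ i, V i = ⊤) {ν : K} (hν : f.HasEigenvalue ν) :
    ∃ i, ν = μ i := by
  by_contra! hne
  refine hν ?_
  have hX : (⊤ : Submodule K E) ≤ ⨆ (ν') (_ : ν' ≠ ν), f.eigenspace ν' :=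
    htop.symm.le.trans (iSup_le fun k => (hV k).trans
      (le_iSup₂_of_le (f := fun ν' (_ : ν' ≠ ν) => f.eigenspace ν') (μ k) (hne k).symm le_rfl))
  exact (f.eigenspaces_iSupIndep ν).eq_bot_of_le (le_top.trans hX)

end

theorem mainTheorem3 (n m : ℕ) (hn : 0 < n) (hm : m ≤ n / 2) :
    ∃ (V : Fin (m + 1) → Submodule ℂ (Combinations n m → ℂ))
      (a : Fin (m + 1) → Fin (m + 1) → ℤ),
      (∀ k, V k ≠ ⊥) ∧ DirectSum.IsInternal V ∧
      (∃ P : MvPolynomial (Fin (m + 1)) ℂ, P ≠ 0 ∧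
        ∀ b : Fin (m + 1) → ℂ, MvPolynomial.eval b P ≠ 0 →
          eigenspaceSet (intertwiningEnd n m b) = Set.range V) ∧
      (∀ (b : Fin (m + 1) → ℂ) (k : Fin (m + 1)),
        V k ≤ (intertwiningEnd n m b).eigenspace (∑ p, (a k p : ℂ) * b p)) ∧
      (∀ (b : Fin (m + 1) → ℂ) (μ : ℂ),
        (intertwiningEnd n m b).HasEigenvalue μ ↔ ∃ k, μ = ∑ p, (a k p : ℂ) * b p) := by
  have h2 : 2 * m ≤ n := by omega
  obtain ⟨a, ha⟩ := exists_johnsonSpace_le_eigenspace n m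
  let V : Fin (m + 1) → Submodule ℂ (Combinations n m → ℂ) := fun k => johnsonSpace n m k
  let c : Fin (m + 1) → (Fin (m + 1) → ℂ) → ℂ := fun k b => ∑ p : Fin (m + 1), (a k p : ℂ) * b p
  have hV : ∀ b k, V k ≤ (intertwiningEnd n m b).eigenspace (c k b) := fun b k => ha b k
  have hbot : ∀ k, V k ≠ ⊥ := fun k => johnsonSpace_ne_bot h2 (Nat.lt_succ_iff.1 k.2)
  have htop : ⨆ k, V k = ⊤ := iSup_johnsonSpace n m
  have heig : ∀ b k, (intertwiningEnd n m b).HasEigenvalue (c k b) := fun b k h =>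
    hbot k (le_bot_iff.1 ((hV b k).trans h.le))
  have hne : ∀ j k : Fin (m + 1), j ≠ k → ∃ b, c j b ≠ c k b := by
    intro j k hjk
    have key : ∀ j k : Fin (m + 1), j < k → ∃ b, c j b ≠ c k b := fun j k hjk =>
      exists_eigenvalue_ne h2 (fun k b => ∑ p : Fin (m + 1), (a k p : ℂ) * b p) ha hjk
        (Nat.lt_succ_iff.1 k.2)
    rcases lt_or_gt_of_ne hjk with h | h
    · exact key j k h
    · obtain ⟨b, hb⟩ := key k j h
      exact ⟨b, hb.symm⟩
  let l : Fin (m + 1) → MvPolynomial (Fin (m + 1)) ℂ := fun k =>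
    ∑ p : Fin (m + 1), MvPolynomial.C (a k p : ℂ) * MvPolynomial.X p
  have hl : ∀ k b, MvPolynomial.eval b (l k) = c k b := fun k b => by simp [l, c]
  let P : MvPolynomial (Fin (m + 1)) ℂ := ∏ x ∈ Finset.univ.offDiag, (l x.1 - l x.2)
  have hP : P ≠ 0 := by
    refine Finset.prod_ne_zero_iff.2 fun x hx h0 => ?_
    obtain ⟨b, hb⟩ := hne x.1 x.2 (Finset.mem_offDiag.1 hx).2.2
    have := congrArg (MvPolynomial.eval b) h0
    rw [map_sub, hl, hl, map_zero] at this
    exact hb (sub_eq_zero.1 this)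
  have hinj : ∀ b, MvPolynomial.eval b P ≠ 0 → Function.Injective fun k => c k b := by
    intro b hb j k hjk
    by_contra hne'
    refine hb ?_
    rw [map_prod]
    refine Finset.prod_eq_zero (i := (j, k)) (by simpa using hne') ?_
    rw [map_sub, hl, hl]
    exact sub_eq_zero.2 hjk
  refine ⟨V, fun k p => a k p, hbot, ?_, ⟨P, hP, fun b hb => ?_⟩, hV, fun b μ => ?_⟩
  -- Directness does not involve b, so one b with distinct eigenvalues suffices.
  · obtain ⟨b, hb⟩ : ∃ b, MvPolynomial.eval b P ≠ 0 := by
      by_contra! h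
      exact hP (MvPolynomial.funext fun b => by rw [h b, map_zero])
    rw [DirectSum.isInternal_submodule_iff_iSupIndep_and_iSup_eq_top]
    exact ⟨((intertwiningEnd n m b).eigenspaces_iSupIndep.comp (hinj b hb)).mono (hV b), htop⟩
  · have hE := eigenspace_eq_of_iSup_eq_top (hinj b hb) (hV b) htop
    ext W
    constructor
    · rintro ⟨μ, hμ, rfl⟩
      obtain ⟨k, rfl⟩ := exists_eq_of_hasEigenvalue (hV b) htop hμ
      exact ⟨k, (hE k).symm⟩
    · rintro ⟨k, rfl⟩
      exact ⟨c k b, heig b k, (hE k).symm⟩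
  · exact ⟨exists_eq_of_hasEigenvalue (hV b) htop, by rintro ⟨k, rfl⟩; exact heig b k⟩
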